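/- **Setting.** A *2-variable positive operator function* $G$ is a map defined on a non-empty set $\mathrm{dom}(G)$ of pairs $A=(A_1,A_2)$ of positive semi-definite operators on $\mathbb C^d$, $d=1,2,\dots$; write $\mathrm{dom}_d(G)$ for the pairs on $\mathbb C^d$. If $A\in\mathrm{dom}_d(G)$ then $G(A)$ is a positive semi-definite operator on $\mathbb C^d$, and for every unitary $V$ on $\mathbb C^d$, $(VA_1V^*,VA_2V^*)\in\mathrm{dom}_d(G)$ and $G(VA_1V^*,VA_2V^*)=VG(A_1,A_2)V^*$. By unitary covariance $G$ extends uniquely to pairs of operators on any finite-dimensional complex Hilbert space $\mathcal H$ that are unitarily equivalent to a pair in $\mathrm{dom}(G)$; the set of these pairs is $\mathrm{dom}_{\mathcal H}(G)$. Write $\mathrm{dom}(G)_{>0}$ for the pairs in $\mathrm{dom}(G)$ with $A_1,A_2$ positive definite, and $\mathrm{dom}_1(G)_{>0}$ for those on $\mathbb C^1$ (pairs of positive numbers). Operator inequalities are in the positive semi-definite order. We say that $G$ * is *strictly scalar positive* if $G(a)>0$ for all $a\in\mathrm{dom}_1(G)_{>0}$; * is *tensor multiplicative* if for all $d\ge1$,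 $A\in\mathrm{dom}_d(G)$ and $n\ge 1$, $(A_1^{\otimes n},A_2^{\otimes n})\in\mathrm{dom}_{(\mathbb C^d)^{\otimes n}}(G)$ and $G(A_1^{\otimes n},A_2^{\otimes n})=G(A)^{\otimes n}$; * is *scalar tensor multiplicative* if for all $a=(a_1,a_2)\in\mathrm{dom}_1(G)$ and $A\in\mathrm{dom}(G)$, $(a_1A_1,a_2A_2)\in\mathrm{dom}(G)$ and $G(a_1A_1,a_2A_2)=G(a)G(A)$; * is *asymptotically individually AM bounded* if for every $A\in\mathrm{dom}(G)$ there are finite positive measures $\mu_n$ on $\{1,2\}$, $n\ge1$, with $G(A)^{\otimes n}\le\mu_n(1)A_1^{\otimes n}+\mu_n(2)A_2^{\otimes n}$ for all $n\ge 1$ and $\limsup_{n\to\infty}\frac1n\log\mu_n(\{1,2\})\le0$; * is *block additive* if for all $r\ge1$ and $(A_i,B_i)\in\mathrm{dom}_{\mathcal H_i}(G)$, $i=1,\dots,r$, one has $(\bigoplus_iA_i,\bigoplus_iB_i)\in\mathrm{dom}_{\bigoplus_i\mathcal H_i}(G)$ and $G(\bigoplus_iA_i,\bigoplus_iB_i)=\bigoplus_iG(A_i,B_i)$;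 * has the *reduction property* if for every $A\in\mathrm{dom}_d(G)$ and every non-zero subspace $\mathcal K\subseteq\mathbb C^d$ invariant under $A_1$ and $A_2$, $(A_1|_{\mathcal K},A_2|_{\mathcal K})\in\mathrm{dom}_{\mathcal K}(G)$; * is *regular* if for every $(A_1,A_2)\in\mathrm{dom}(G)$ there is $\delta>0$ with $(A_1+\varepsilon I,A_2+\varepsilon I)\in\mathrm{dom}(G)$ for all $\varepsilon\in(0,\delta)$, and $G(A_1,A_2)=\lim_{\varepsilon\searrow0}G(A_1+\varepsilon I,A_2+\varepsilon I)$; * is a *$\nu$-weighted operator geometric mean*, for a probability distribution $\nu$ on $\{1,2\}$, if for every $d\ge 1$ and every commuting pair of positive definite operators $A_1,A_2$ on $\mathbb C^d$, $(A_1,A_2)\in\mathrm{dom}(G)$ and $G(A_1,A_2)=\exp(\nu(1)\log A_1+\nu(2)\log A_2)$. For $t\in[0,1]$, the $t$-weighted Kubo–Ando geometric mean is $B\#_tA:=B^{1/2}(B^{-1/2}AB^{-1/2})^tB^{1/2}$ for positive definite $A,B$, and $B\#_tA:=\lim_{\varepsilon\searrow0}(B+\varepsilon I)\#_t(A+\varepsilon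 I)$ for positive semi-definite $A,B$. **Theorem.** Let $G$ be a 2-variable positive operator function that is strictly scalar positive, tensor multiplicative, scalar tensor multiplicative, asymptotically individually AM bounded, block additive, and has the reduction property. (1) Suppose in addition that $\mathrm{dom}_1(G)_{>0}$ is closed under inversion: $(a_1,a_2)\in\mathrm{dom}_1(G)_{>0}$ implies $(a_1^{-1},a_2^{-1})\in\mathrm{dom}_1(G)$. (This holds, for example, if $\mathrm{dom}(G)$ contains all pairs of positive definite operators.) Then there is a $t\in[0,1]$ such that $G(A_1,A_2)=A_2\#_tA_1$ for every $(A_1,A_2)\in\mathrm{dom}(G)_{>0}$; if, moreover, $G$ is regular, then with the same $t$ this holds for every $(A_1,A_2)\in\mathrm{dom}(G)$. (2) If $G$ is a $\nu$-weighted operator geometric mean for a probability distribution $\nu$ on $\{1,2\}$, then $G(A_1,A_2)=A_2\#_{\nu(1)}A_1=G^{\mathrm{KA}}_\nu(A_1,A_2)$ for every $(A_1,A_2)\in\mathrm{dom}(G)_{>0}$, and for every $(A_1,A_2)\in\mathrm{dom}(G)$ if $G$ is regular. -/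

import Mathlib

open Filter Topology Set
open scoped NNReal ENNReal

noncomputable section

/-- The Hilbert space `ℂ^d`. -/
abbrev CSpace (d : ℕ) : Type := EuclideanSpace ℂ (Fin d)

/-- The algebra `B(H)` of bounded operators, with the Löwner order. -/
abbrev Op (H : Type) [NormedAddCommGroup H] [InnerProductSpace ℂ H] : Type := H →L[ℂ] H

section Hilbert

variable {H K L : Type} [NormedAddCommGroup H] [InnerProductSpace ℂ H]
  [NormedAddCommGroup K] [InnerProductSpace ℂ K] [NormedAddCommGroup L] [InnerProductSpace ℂ L]

/-- The conjugation `V A V*` of an operator `A` on `H` by a unitary `V : H → K`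
(for which `V* = V⁻¹`). -/
def unitaryConj (V : H ≃ₗᵢ[ℂ] K) (A : Op H) : Op K :=
  (V : H →L[ℂ] K) ∘L A ∘L (V.symm : K →L[ℂ] H)

@[simp] theorem unitaryConj_apply (V : H ≃ₗᵢ[ℂ] K) (A : Op H) (x : K) :
    unitaryConj V A x = V (A (V.symm x)) := rfl

theorem unitaryConj_trans (V : H ≃ₗᵢ[ℂ] K) (W : K ≃ₗᵢ[ℂ] L) (A : Op H) :
    unitaryConj W (unitaryConj V A) = unitaryConj (V.trans W) A := rfl

theorem unitaryConj_symm_self (V : H ≃ₗᵢ[ℂ] K) (A : Op H) :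
    unitaryConj V.symm (unitaryConj V A) = A := by
  ext x; simp

theorem unitaryConj_self_symm (V : H ≃ₗᵢ[ℂ] K) (A : Op K) :
    unitaryConj V (unitaryConj V.symm A) = A := by
  ext x; simp

end Hilbert

/-- The Hilbert space `(ℂ^d)^{⊗ n}`, in its coordinates with respect to the orthonormal basis
`e_{j 1} ⊗ ⋯ ⊗ e_{j n}`. -/
abbrev TensorSpace (d n : ℕ) : Type := EuclideanSpace ℂ (Fin n → Fin d)

/-- The product vector `v 1 ⊗ ⋯ ⊗ v n`. -/
def tensorVec {d n : ℕ} (v : Fin n → CSpace d) : TensorSpace d n :=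
  WithLp.toLp 2 fun i => ∏ k, v k (i k)

/-- The tensor power `A^{⊗ n}`, through its matrix elements
`⟨e_i, A^{⊗ n} e_j⟩ = ∏ k, ⟨e_{i k}, A e_{j k}⟩`. -/
def tensorPow {d : ℕ} (n : ℕ) (A : Op (CSpace d)) : Op (TensorSpace d n) :=
  Matrix.toEuclideanCLM (n := Fin n → Fin d) (𝕜 := ℂ)
    (Matrix.of fun i j => ∏ k, A (EuclideanSpace.single (j k) 1) (i k))

/-- `A^{⊗ n}` acts on product vectors as it should. -/
theorem tensorPow_tensorVec {d n : ℕ} (A : Op (CSpace d)) (v : Fin n → CSpace d) :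
    tensorPow n A (tensorVec v) = tensorVec fun k => A (v k) := by
  have key : ∀ (x : CSpace d) (i : Fin d),
      A x i = ∑ j, A (EuclideanSpace.single j 1) i * x j := by
    intro x i
    have hx : x = ∑ j, x j • EuclideanSpace.single j (1 : ℂ) := by
      ext l; simp [Pi.single_apply]
    conv_lhs => rw [hx]
    simp [map_sum, mul_comm]
  ext i
  simp only [tensorPow, tensorVec, Matrix.toEuclideanCLM_toLp, Matrix.mulVec, dotProduct,
    Matrix.of_apply]
  simp only [← Finset.prod_mul_distrib]
  simp_rw [key (v _)]
  rw [Finset.prod_univ_sum]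
  simp

/-- The direct sum `⊕ᵢ Aᵢ` on the Hilbert space direct sum `⊕ᵢ Hᵢ`. -/
def directSumOp {r : ℕ} {H : Fin r → Type} [∀ i, NormedAddCommGroup (H i)]
    [∀ i, InnerProductSpace ℂ (H i)] (A : ∀ i, Op (H i)) : Op (PiLp 2 H) :=
  ((PiLp.continuousLinearEquiv 2 ℂ H).symm : (∀ i, H i) →L[ℂ] PiLp 2 H) ∘L
    ContinuousLinearMap.piMap A ∘L
      ((PiLp.continuousLinearEquiv 2 ℂ H) : PiLp 2 H →L[ℂ] (∀ i, H i))

@[simp] theorem directSumOp_apply {r : ℕ} {H : Fin r → Type} [∀ i, NormedAddCommGroup (H i)]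
    [∀ i, InnerProductSpace ℂ (H i)] (A : ∀ i, Op (H i)) (x : PiLp 2 H) (i : Fin r) :
    directSumOp A x i = A i (x i) := rfl

/-- The scalar represented by an operator on the one-dimensional space `ℂ^1`. -/
def toScalar (a : Op (CSpace 1)) : ℂ := a (EuclideanSpace.single 0 1) 0

theorem toScalar_smul_one (z : ℂ) : toScalar (z • (1 : Op (CSpace 1))) = z := by
  simp [toScalar]

/-- A `Y`-variable positive operator function, for a set `Y` (with all its subsets as measurable
sets; the case used below is a two-point set). `dom d` is the set of those families of positive
semi-definite operators on `ℂ^d` on which the function is defined; the values of `toFun` outside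
of the domain carry no meaning. The natural numbers `d` start at `1`. -/
structure PositiveOperatorFunction (Y : Type) where
  dom : (d : ℕ) → Set (Y → Op (CSpace d))
  toFun : (d : ℕ) → (Y → Op (CSpace d)) → Op (CSpace d)
  dom_nonempty : ∃ d, (dom d).Nonempty
  dim_pos : ∀ {d : ℕ} {A : Y → Op (CSpace d)}, A ∈ dom d → 0 < d
  nonneg_of_mem_dom : ∀ {d : ℕ} {A : Y → Op (CSpace d)}, A ∈ dom d → ∀ y, 0 ≤ A y
  nonneg : ∀ {d : ℕ} {A : Y → Op (CSpace d)}, A ∈ dom d → 0 ≤ toFun d A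
  unitary_mem : ∀ {d : ℕ} {A : Y → Op (CSpace d)} (V : CSpace d ≃ₗᵢ[ℂ] CSpace d),
    A ∈ dom d → (fun y => unitaryConj V (A y)) ∈ dom d
  unitary_map : ∀ {d : ℕ} {A : Y → Op (CSpace d)} (V : CSpace d ≃ₗᵢ[ℂ] CSpace d),
    A ∈ dom d → toFun d (fun y => unitaryConj V (A y)) = unitaryConj V (toFun d A)

namespace PositiveOperatorFunction

variable {Y : Type} (G : PositiveOperatorFunction Y)

/-- The families in the domain that consist of positive definite operators. -/
def domPos (d : ℕ) : Set (Y → Op (CSpace d)) :=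
  {A | A ∈ G.dom d ∧ ∀ y, IsStrictlyPositive (A y)}

section Extension

variable (H : Type) [NormedAddCommGroup H] [InnerProductSpace ℂ H]

/-- The domain of the extension of `G` to operators on a finite-dimensional Hilbert space `H`. -/
def domOn : Set (Y → Op H) :=
  {A | ∃ (d : ℕ) (V : H ≃ₗᵢ[ℂ] CSpace d), (fun y => unitaryConj V (A y)) ∈ G.dom d}

variable {H}

theorem mem_dom_and_valOn_eq {d : ℕ} (V W : H ≃ₗᵢ[ℂ] CSpace d) (A : Y → Op H)
    (hA : (fun y => unitaryConj V (A y)) ∈ G.dom d) :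
    (fun y => unitaryConj W (A y)) ∈ G.dom d ∧
      unitaryConj W.symm (G.toFun d fun y => unitaryConj W (A y)) =
        unitaryConj V.symm (G.toFun d fun y => unitaryConj V (A y)) := by
  have e : ∀ y, unitaryConj (V.symm.trans W) (unitaryConj V (A y)) = unitaryConj W (A y) := by
    intro y; ext x; simp
  have h1 := G.unitary_mem (V.symm.trans W) hA
  have h2 := G.unitary_map (V.symm.trans W) hA
  simp only [e] at h1 h2
  refine ⟨h1, ?_⟩
  rw [h2]
  ext x; simp

theorem mem_domOn_iff {d : ℕ} (V : H ≃ₗᵢ[ℂ] CSpace d) (A : Y → Op H) :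
    A ∈ G.domOn H ↔ (fun y => unitaryConj V (A y)) ∈ G.dom d := by
  refine ⟨?_, fun h => ⟨d, V, h⟩⟩
  rintro ⟨d', W, hW⟩
  have hd : d' = d := by
    have h1 := W.toLinearEquiv.finrank_eq
    have h2 := V.toLinearEquiv.finrank_eq
    simp only [finrank_euclideanSpace, Fintype.card_fin] at h1 h2
    omega
  subst hd
  exact (G.mem_dom_and_valOn_eq W V A hW).1

variable [FiniteDimensional ℂ H]

/-- The extension of `G` to operators on a finite-dimensional Hilbert space `H`:
`G(A) = V* G(V A V*) V`, with `V` taken from a fixed orthonormal basis of `H`; by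
`mem_domOn_iff` and `valOn_eq`, every other unitary `V : H → ℂ^d` gives the same. -/
def valOn (A : Y → Op H) : Op H :=
  unitaryConj (stdOrthonormalBasis ℂ H).repr.symm
    (G.toFun (Module.finrank ℂ H) fun y => unitaryConj (stdOrthonormalBasis ℂ H).repr (A y))

theorem valOn_eq {d : ℕ} (V : H ≃ₗᵢ[ℂ] CSpace d) (A : Y → Op H) (hA : A ∈ G.domOn H) :
    G.valOn A = unitaryConj V.symm (G.toFun d fun y => unitaryConj V (A y)) := by
  have hd : Module.finrank ℂ H = d := by
    have h2 := V.toLinearEquiv.finrank_eq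
    simpa using h2
  subst hd
  exact (G.mem_dom_and_valOn_eq V _ A ((G.mem_domOn_iff V A).1 hA)).2

end Extension

/-- Strict scalar positivity. -/
def StrictlyScalarPositive : Prop :=
  ∀ a ∈ G.domPos 1, IsStrictlyPositive (G.toFun 1 a)

/-- Tensor multiplicativity: `A^{⊗ n}` is in the domain and `G(A^{⊗ n}) = G(A)^{⊗ n}`. -/
def TensorMultiplicative : Prop :=
  ∀ (d : ℕ), ∀ A ∈ G.dom d, ∀ n : ℕ, 1 ≤ n →
    (fun y => tensorPow n (A y)) ∈ G.domOn (TensorSpace d n) ∧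
      G.valOn (fun y => tensorPow n (A y)) = tensorPow n (G.toFun d A)

/-- Scalar tensor multiplicativity: `(a_y A_y)_y` is in the domain and `G(a A) = G(a) G(A)`. -/
def ScalarTensorMultiplicative : Prop :=
  ∀ a ∈ G.dom 1, ∀ (d : ℕ), ∀ A ∈ G.dom d,
    (fun y => toScalar (a y) • A y) ∈ G.dom d ∧
      G.toFun d (fun y => toScalar (a y) • A y) = toScalar (G.toFun 1 a) • G.toFun d A

/-- Asymptotic individual arithmetic mean boundedness: for every `A` in the domain there are
finite positive measures `μ n` on the finite set `Y` (given by their weights) with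
`G(A)^{⊗ n} ≤ ∫ A_y^{⊗ n} dμ n(y)` for all `n ≥ 1`, and `limsup (1/n) log μ n(Y) ≤ 0`. -/
def AsymptoticallyIndividuallyAMBounded [Fintype Y] : Prop :=
  ∀ (d : ℕ), ∀ A ∈ G.dom d, ∃ μ : ℕ → Y → ℝ≥0,
    (∀ n : ℕ, 1 ≤ n →
      tensorPow n (G.toFun d A) ≤ ∑ y, ((μ n y : ℝ) : ℂ) • tensorPow n (A y)) ∧
    limsup (fun n : ℕ => ENNReal.log (∑ y, (μ n y : ℝ≥0∞)) / (n : EReal)) atTop ≤ 0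

/-- Block additivity: a finite direct sum of families in the domain is in the domain, and
`G(⊕ᵢ Aᵢ) = ⊕ᵢ G(Aᵢ)`. -/
def BlockAdditive : Prop :=
  ∀ (r : ℕ), 1 ≤ r → ∀ (H : Fin r → Type) [∀ i, NormedAddCommGroup (H i)]
    [∀ i, InnerProductSpace ℂ (H i)] [∀ i, FiniteDimensional ℂ (H i)]
    (A : ∀ i, Y → Op (H i)), (∀ i, A i ∈ G.domOn (H i)) →
      (fun y => directSumOp fun i => A i y) ∈ G.domOn (PiLp 2 H) ∧
        G.valOn (fun y => directSumOp fun i => A i y) = directSumOp fun i => G.valOn (A i)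

/-- The reduction property: the domain is closed under restriction to non-zero subspaces that are
invariant under all members of the family. -/
def ReductionProperty : Prop :=
  ∀ (d : ℕ), ∀ A ∈ G.dom d, ∀ K : Submodule ℂ (CSpace d), K ≠ ⊥ →
    ∀ hK : ∀ y, MapsTo (A y) K K,
      (fun y => ((A y).restrict (hK y) : Op K)) ∈ G.domOn K

/-- Closedness of the positive scalar part of the domain under inversion: if the family of
positive numbers `(a_y)_y` is in the domain then so is `(1 / a_y)_y`. -/
def ScalarDomainInvClosed : Prop :=
  ∀ a : Y → ℝ, (∀ y, 0 < a y) →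
    (fun y => ((a y : ℝ) : ℂ) • (1 : Op (CSpace 1))) ∈ G.dom 1 →
    (fun y => (((a y)⁻¹ : ℝ) : ℂ) • (1 : Op (CSpace 1))) ∈ G.dom 1

/-- Regularity. -/
def Regular : Prop :=
  ∀ (d : ℕ), ∀ A ∈ G.dom d,
    (∃ δ : ℝ, 0 < δ ∧ ∀ ε ∈ Ioo 0 δ, (fun y => A y + (ε : ℂ) • 1) ∈ G.dom d) ∧
    Tendsto (fun ε : ℝ => G.toFun d fun y => A y + (ε : ℂ) • 1) (𝓝[>] 0) (𝓝 (G.toFun d A))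

/-- `G` is a `ν`-weighted operator geometric mean: every commuting family `A` of positive definite
operators is in the domain, with `G(A) = exp (∑ y, ν y • log (A y))`. -/
def IsWeightedGeometricMean [Fintype Y] (ν : Y → ℝ) : Prop :=
  ∀ (d : ℕ), 1 ≤ d → ∀ A : Y → Op (CSpace d), (∀ y, IsStrictlyPositive (A y)) →
    (∀ y z, Commute (A y) (A z)) →
      A ∈ G.dom d ∧ G.toFun d A = NormedSpace.exp (∑ y, (ν y : ℂ) • CFC.log (A y))

end PositiveOperatorFunction

/-- The `t`-weighted Kubo-Ando geometric mean `B #_t A` of positive definite operators. -/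
def kuboAndo {d : ℕ} (t : ℝ) (B A : Op (CSpace d)) : Op (CSpace d) :=
  B ^ (1 / 2 : ℝ) * (B ^ (-(1 / 2) : ℝ) * A * B ^ (-(1 / 2) : ℝ)) ^ t * B ^ (1 / 2 : ℝ)

/-- `X` is the `t`-weighted Kubo-Ando geometric mean `B #_t A` of the positive semi-definite
operators `A`, `B`, that is, `X = lim_{ε ↘ 0} (B + ε I) #_t (A + ε I)`. -/
def IsKuboAndo {d : ℕ} (t : ℝ) (B A X : Op (CSpace d)) : Prop :=
  Tendsto (fun ε : ℝ => kuboAndo t (B + (ε : ℂ) • 1) (A + (ε : ℂ) • 1)) (𝓝[>] 0) (𝓝 X)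

end

/-!
The antisymmetric vector is a common eigenvector of the operators `T^{⊗ d}`, with eigenvalues
`det T`, so tensor multiplicativity and the reduction property give `G(det A₁, det A₂) = det G(A)`.
Powers of these scalars may therefore be divided out of the bound on `G(A)^{⊗ N}`. Tested on product
vectors of a basis `b` of `ℂ^d`, it then says that, for the matrices `⟨bᵢ, T bⱼ⟩` of the forms of
`A₁`, `A₂` and `G(A)`, an upper bound on monomials in the diagonal entries, divided by a power of
the determinant, passes from `A₁` and `A₂` to `G(A)`.

Take `b` to diagonalize the form of `A₁` relative to that of `A₂`. The monomial
`∏ⱼ ⟨bⱼ, T bⱼ⟩ / det` yields equality in Hadamard's inequality for `G(A)`, whose form is therefore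
also diagonal. For its entries `z` and the entries `x` of `A₁` the remaining monomials give
`∑ vⱼ log zⱼ ≤ max (∑ vⱼ log xⱼ) 0` for all integer vectors `v`, which forces `log z = t • log x`
with `0 ≤ t ≤ 1`, that is, `G(A) = A₂ #_t A₁`. By block additivity, `t` can be chosen independently
of `A`.
-/

noncomputable section

section Scalars

theorem addMonoidHom_eq_zero_of_bddAbove {M K : Type*} [AddGroup M] [AddCommGroup K]
    [LinearOrder K] [IsOrderedAddMonoid K] [Archimedean K] {f : M →+ K}
    (hf : BddAbove (range f)) : f = 0 := by
  obtain ⟨c, hc⟩ := hf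
  have hle : ∀ v, f v ≤ 0 := by
    intro v
    by_contra! hv
    obtain ⟨n, hn⟩ := Archimedean.arch c hv
    have hlt : c < f ((n + 1) • v) := by
      rw [map_nsmul, succ_nsmul]
      exact hn.trans_lt (lt_add_of_pos_right _ hv)
    exact hlt.not_ge (hc ⟨_, rfl⟩)
  ext v
  exact (hle v).antisymm (neg_nonpos.1 (map_neg f v ▸ hle (-v)))

/-- With `l e > 0` and `t = f e / l e`, the functional `f - t l` is invariant under translation by
`e`; as every `v` has a translate with `0 ≤ l v < l e`, it is bounded above, hence zero. -/
theorem exists_eq_mul_of_le_max {M K : Type*} [AddCommGroup M] [Field K] [LinearOrder K]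
    [IsStrictOrderedRing K] [Archimedean K] {f l : M →+ K} (h : ∀ v, f v ≤ max (l v) 0) :
    ∃ t ∈ Icc (0 : K) 1, ∀ v, f v = t * l v := by
  obtain rfl | hl := eq_or_ne l 0
  · obtain rfl : f = 0 := addMonoidHom_eq_zero_of_bddAbove ⟨0, by
      rintro _ ⟨v, rfl⟩
      simpa using h v⟩
    exact ⟨0, ⟨le_rfl, zero_le_one⟩, by simp⟩
  obtain ⟨e, he⟩ : ∃ e, 0 < l e := by
    obtain ⟨v, hv⟩ := DFunLike.ne_iff.1 hl
    obtain hv | hv := lt_or_gt_of_ne hv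
    · exact ⟨-v, by simpa using hv⟩
    · exact ⟨v, hv⟩
  have hfe : f e ≤ l e := by simpa [he.le] using h e
  have hfe0 : 0 ≤ f e := by simpa [he.le] using h (-e)
  have ht0 : 0 ≤ f e / l e := by positivity
  let g : M →+ K := f - (AddMonoidHom.mulLeft (f e / l e)).comp l
  have hg : ∀ v, g v = f v - f e / l e * l v := fun _ => rfl
  have hge : g e = 0 := by rw [hg, div_mul_cancel₀ _ he.ne', sub_self]
  have hgle : ∀ v, g v ≤ l e := by
    intro v
    obtain ⟨m, ⟨hm0, hm1⟩, -⟩ := existsUnique_sub_zsmul_mem_Ico he (l v) 0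
    rw [zero_add] at hm1
    have hlv : l (v - m • e) = l v - m • l e := by rw [map_sub, map_zsmul]
    calc g v = g (v - m • e) := by rw [map_sub, map_zsmul, hge, smul_zero, sub_zero]
      _ ≤ f (v - m • e) := sub_le_self _ (mul_nonneg ht0 (hlv ▸ hm0))
      _ ≤ max (l (v - m • e)) 0 := h _
      _ ≤ l e := max_le (hlv ▸ hm1.le) he.le
  have hg0 : g = 0 := addMonoidHom_eq_zero_of_bddAbove ⟨l e, by rintro _ ⟨v, rfl⟩; exact hgle v⟩
  exact ⟨f e / l e, ⟨ht0, (div_le_one he).2 hfe⟩,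
    fun v => sub_eq_zero.1 (DFunLike.congr_fun hg0 v)⟩

theorem exists_rpow_eq_of_prod_zpow_le_max {ι : Type*} [Fintype ι] {x y : ι → ℝ}
    (hx : ∀ i, 0 < x i) (hy : ∀ i, 0 < y i)
    (h : ∀ v : ι → ℤ, ∏ i, y i ^ v i ≤ max (∏ i, x i ^ v i) 1) :
    ∃ t ∈ Icc (0 : ℝ) 1, ∀ i, y i = x i ^ t := by
  classical
  let logHom (z : ι → ℝ) : (ι → ℤ) →+ ℝ :=
    { toFun := fun v => ∑ i, v i * Real.log (z i)
      map_zero' := by simp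
      map_add' := fun v w => by simp [add_mul, Finset.sum_add_distrib] }
  have hlog : ∀ {z : ι → ℝ}, (∀ i, 0 < z i) → ∀ v, logHom z v = Real.log (∏ i, z i ^ v i) := by
    intro z hz v
    rw [Real.log_prod fun i _ => (zpow_pos (hz i) _).ne']
    exact Finset.sum_congr rfl fun i _ => (Real.log_zpow _ _).symm
  have hmax : ∀ v, logHom y v ≤ max (logHom x v) 0 := by
    intro v
    have hprod : ∀ {z : ι → ℝ}, (∀ i, 0 < z i) → 0 < ∏ i, z i ^ v i := fun hz =>
      Finset.prod_pos fun i _ => zpow_pos (hz i) _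
    rw [hlog hx, hlog hy, ← Real.log_one,
      ← Real.strictMonoOn_log.monotoneOn.map_max (hprod hx) (mem_Ioi.2 one_pos)]
    exact Real.log_le_log (hprod hy) (h v)
  obtain ⟨t, ht, hlin⟩ := exists_eq_mul_of_le_max hmax
  refine ⟨t, ht, fun i => Real.log_injOn_pos (hy i) (Real.rpow_pos_of_pos (hx i) t) ?_⟩
  have hsingle : ∀ z, logHom z (Pi.single i 1) = Real.log (z i) := fun z => by
    simp [logHom, Pi.single_apply]
  rw [Real.log_rpow (hx i), ← hsingle, ← hsingle, hlin]

theorem eq_one_of_one_le_prod_of_sum_le_card {ι : Type*} [Fintype ι] {x : ι → ℝ}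
    (hx : ∀ i, 0 ≤ x i) (hsum : ∑ i, x i ≤ Fintype.card ι) (hprod : 1 ≤ ∏ i, x i) (i : ι) :
    x i = 1 := by
  have hpos : ∀ i, 0 < x i := fun i => (hx i).lt_of_ne' fun h =>
    absurd (Finset.prod_eq_zero (Finset.mem_univ i) h) (by positivity)
  by_contra hi
  have hlt : ∑ i, Real.log (x i) < ∑ i, (x i - 1) :=
    Finset.sum_lt_sum (fun i _ => Real.log_le_sub_one_of_pos (hpos i))
      ⟨i, Finset.mem_univ i, Real.log_lt_sub_one_of_pos (hpos i) hi⟩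
  have hlog : 0 ≤ ∑ i, Real.log (x i) := by
    rw [← Real.log_prod fun i _ => (hpos i).ne']
    exact Real.log_nonneg hprod
  simp only [Finset.sum_sub_distrib, Finset.sum_const, Finset.card_univ, nsmul_eq_mul,
    mul_one] at hlt
  linarith

theorem le_one_of_pow_le_of_limsup_log_le {s : ℕ → ℝ≥0∞} {r : ℝ}
    (hs : limsup (fun n : ℕ => ENNReal.log (s n) / (n : EReal)) atTop ≤ 0)
    (h : ∀ n : ℕ, 1 ≤ n → ENNReal.ofReal (r ^ n) ≤ s n) : r ≤ 1 := by
  by_contra! hr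
  have hlog_le : ∀ n : ℕ, 1 ≤ n → ((Real.log r : ℝ) : EReal) ≤ ENNReal.log (s n) / (n : EReal) := by
    intro n hn
    rw [EReal.le_div_iff_mul_le (by exact_mod_cast hn) (EReal.natCast_ne_top n)]
    calc ((Real.log r : ℝ) : EReal) * n = ENNReal.log (ENNReal.ofReal (r ^ n)) := by
          rw [ENNReal.log_ofReal_of_pos (by positivity), Real.log_pow, mul_comm]
          push_cast
          rfl
      _ ≤ ENNReal.log (s n) := ENNReal.log_le_log (h n hn)
  have hlog : ((Real.log r : ℝ) : EReal) ≤ 0 :=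
    (le_liminf_of_le (h := eventually_atTop.2 ⟨1, hlog_le⟩)).trans (le_trans liminf_le_limsup hs)
  exact (Real.log_pos hr).not_ge (EReal.coe_le_coe_iff.1 hlog)

theorem prod_pow_toNat_add {ι K : Type*} [Fintype ι] [CommGroupWithZero K] {x : ι → K}
    (hx : ∀ j, x j ≠ 0) {v : ι → ℤ} {n : ℕ} (hv : ∀ j, 0 ≤ v j + n) :
    ∏ j, x j ^ (v j + n).toNat = (∏ j, x j ^ v j) * (∏ j, x j) ^ n := by
  rw [← Finset.prod_pow, ← Finset.prod_mul_distrib]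
  refine Finset.prod_congr rfl fun j _ => ?_
  rw [← zpow_natCast, Int.toNat_of_nonneg (hv j), zpow_add₀ (hx j), zpow_natCast]

end Scalars

section Matrices

open scoped ComplexOrder

variable {n 𝕜 : Type*} [Fintype n] [DecidableEq n] [RCLike 𝕜] {Z : Matrix n n 𝕜}

theorem eq_one_of_posSemidef_of_trace_le_of_one_le_det (hZ : Z.PosSemidef)
    (htrace : Z.trace ≤ Fintype.card n) (hdet : 1 ≤ Z.det) : Z = 1 := by
  have hsum : ∑ i, hZ.isHermitian.eigenvalues i ≤ Fintype.card n := by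
    rw [hZ.isHermitian.trace_eq_sum_eigenvalues] at htrace
    exact_mod_cast htrace
  have hprod : 1 ≤ ∏ i, hZ.isHermitian.eigenvalues i := by
    rw [hZ.isHermitian.det_eq_prod_eigenvalues] at hdet
    exact_mod_cast hdet
  have hone := eq_one_of_one_le_prod_of_sum_le_card hZ.eigenvalues_nonneg hsum hprod
  have hdiag : RCLike.ofReal ∘ hZ.isHermitian.eigenvalues = fun _ : n => (1 : 𝕜) := by
    ext i
    simp [hone]
  rw [hZ.isHermitian.spectral_theorem, hdiag, Matrix.diagonal_one, map_one]

theorem exists_pos_mul_mul_eq_one {z : 𝕜} (hz : 0 < z) : ∃ r : ℝ, 0 < r ∧ (r : 𝕜) * z * r = 1 := by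
  obtain ⟨y, hy, rfl⟩ := RCLike.pos_iff_exists_ofReal.1 hz
  have hsqrt := Real.sqrt_pos.2 hy
  refine ⟨(√y)⁻¹, inv_pos.2 hsqrt, ?_⟩
  norm_cast
  nth_rw 2 [← Real.mul_self_sqrt hy.le]
  field_simp

theorem isDiag_of_posDef_of_prod_diag_le_det (hZ : Z.PosDef) (hdet : ∏ i, Z i i ≤ Z.det) :
    Z.IsDiag := by
  choose r hr hrZr using fun i => exists_pos_mul_mul_eq_one (hZ.diag_pos (i := i))
  let s : n → 𝕜 := fun i => r i
  have hs : ∀ i, 0 < s i := fun i => RCLike.ofReal_pos.2 (hr i)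
  have hsZs : ∀ i, s i * Z i i * s i = 1 := hrZr
  let E := Matrix.diagonal s
  have hentry : ∀ i j, (E * Z * E) i j = s i * Z i j * s j := fun i j => by
    simp [E, Matrix.mul_diagonal, Matrix.diagonal_mul]
  have hps : (E * Z * E).PosSemidef := by
    have hE : E.conjTranspose = E := by
      rw [Matrix.diagonal_conjTranspose]
      congr 1
      ext i
      simp [s]
    simpa only [hE] using hZ.posSemidef.conjTranspose_mul_mul_same E
  have hdetE : 1 ≤ (E * Z * E).det := by
    calc 1 = (∏ i, s i) * (∏ i, Z i i) * ∏ i, s i := by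
          rw [← Finset.prod_mul_distrib, ← Finset.prod_mul_distrib,
            Finset.prod_eq_one fun i _ => hsZs i]
      _ ≤ (∏ i, s i) * Z.det * ∏ i, s i := by
          gcongr <;> exact Finset.prod_nonneg fun i _ => (hs i).le
      _ = (E * Z * E).det := by rw [Matrix.det_mul, Matrix.det_mul, Matrix.det_diagonal]
  have hone : E * Z * E = 1 :=
    eq_one_of_posSemidef_of_trace_le_of_one_le_det hps (by simp [Matrix.trace, hentry, hsZs]) hdetE
  intro i j hij
  have hzero := hentry i j
  rw [hone, Matrix.one_apply_ne hij] at hzero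
  simpa [(hs i).ne', (hs j).ne'] using hzero.symm

end Matrices

section Forms

variable {H ι : Type} [NormedAddCommGroup H] [InnerProductSpace ℂ H]

/-- The matrix `⟨wᵢ, T wⱼ⟩` of the sesquilinear form of an operator `T` in a family of vectors `w`;
the Gram matrix of `w` is the case `T = 1`. -/
def formMatrix (T : Op H) (w : ι → H) : Matrix ι ι ℂ :=
  Matrix.of fun i j => inner ℂ (w i) (T (w j))

theorem formMatrix_apply (T : Op H) (w : ι → H) (i j : ι) :
    formMatrix T w i j = inner ℂ (w i) (T (w j)) := rfl

theorem det_formMatrix [Fintype ι] [DecidableEq ι] (T : Op H) (b : Module.Basis ι ℂ H) :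
    (formMatrix T b).det = (formMatrix 1 b).det * LinearMap.det (T : H →ₗ[ℂ] H) := by
  rw [← LinearMap.det_toMatrix b, ← Matrix.det_mul]
  congr 1
  ext i j
  rw [formMatrix_apply, ← b.sum_repr (T (b j)), inner_sum, Matrix.mul_apply]
  refine Finset.sum_congr rfl fun k _ => ?_
  rw [inner_smul_right, mul_comm, LinearMap.toMatrix_apply]
  rfl

theorem formMatrix_eq_diagonal_iff [DecidableEq ι] {A B : Op H} {b : Module.Basis ι ℂ H}
    (hB : formMatrix B b = 1) {x : ι → ℂ} :
    formMatrix A b = Matrix.diagonal x ↔ ∀ j, A (b j) = x j • B (b j) := by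
  have hBx : ∀ i j, inner ℂ (b i) (x j • B (b j)) = Matrix.diagonal x i j := fun i j => by
    rw [inner_smul_right, ← formMatrix_apply, hB, ← smul_eq_mul, Matrix.one_apply,
      Matrix.diagonal_apply]
    split_ifs with h <;> simp [h]
  refine ⟨fun h j => InnerProductSpace.ext_inner_left_basis b fun i => ?_, fun h => ?_⟩
  · rw [hBx, ← h, formMatrix_apply]
  · ext i j
    rw [← hBx, formMatrix_apply, h]

variable [FiniteDimensional ℂ H] [CompleteSpace H] {T : Op H}

theorem isStrictlyPositive_iff_injective (hT : 0 ≤ T) :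
    IsStrictlyPositive T ↔ Function.Injective T := by
  refine ⟨fun h => (ContinuousLinearMap.isUnit_iff_bijective.1 h.isUnit).1, fun h => ⟨hT, ?_⟩⟩
  exact ContinuousLinearMap.isUnit_iff_bijective.2
    ⟨h, LinearMap.injective_iff_surjective (f := (T : H →ₗ[ℂ] H)).1 h⟩

open scoped ComplexOrder in
theorem posDef_formMatrix [Finite ι] (hT : IsStrictlyPositive T) {w : ι → H}
    (hw : LinearIndependent ℂ w) : (formMatrix T w).PosDef := by
  obtain ⟨S, hS, hST⟩ : ∃ S : Op H, IsSelfAdjoint S ∧ S * S = T :=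
    ⟨CFC.sqrt T, .of_nonneg (CFC.sqrt_nonneg T), CFC.sqrt_mul_sqrt_self T hT.nonneg⟩
  have hinj : Function.Injective S := fun v v' h =>
    (isStrictlyPositive_iff_injective hT.nonneg).1 hT (by
      rw [← hST, mul_apply_eq_comp, mul_apply_eq_comp, h])
  have hgram : formMatrix T w = Matrix.gram ℂ (S ∘ w) := by
    ext i j
    rw [formMatrix_apply, ← hST, mul_apply_eq_comp, Matrix.gram_apply, Function.comp_apply,
      Function.comp_apply, ← ContinuousLinearMap.adjoint_inner_left, hS.adjoint_eq]
  rw [hgram]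
  exact Matrix.posDef_gram_of_linearIndependent
    (hw.map' (S : H →ₗ[ℂ] H) (LinearMap.ker_eq_bot.2 hinj))

open scoped ComplexOrder in
theorem pos_of_formMatrix_eq_diagonal [Finite ι] [DecidableEq ι] (hT : IsStrictlyPositive T)
    {w : ι → H} (hw : LinearIndependent ℂ w) {p : ι → ℝ}
    (h : formMatrix T w = Matrix.diagonal fun j => (p j : ℂ)) (j : ι) : 0 < p j := by
  have hdiag := (posDef_formMatrix hT hw).diag_pos (i := j)
  rw [h, Matrix.diagonal_apply_eq] at hdiag
  exact_mod_cast hdiag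

end Forms

section KuboAndo

theorem cfc_apply_of_eigenvector {H : Type} [NormedAddCommGroup H] [InnerProductSpace ℂ H]
    [FiniteDimensional ℂ H] [CompleteSpace H] {T : Op H} (hT : IsSelfAdjoint T) (f : ℝ → ℝ)
    {v : H} {x : ℝ} (hv : T v = (x : ℂ) • v) : cfc f T v = (f x : ℂ) • v := by
  have hfin : (spectrum ℝ T).Finite := by
    rw [← spectrum.preimage_algebraMap ℂ, ContinuousLinearMap.spectrum_eq]
    exact (Module.End.finite_spectrum _).preimage (FaithfulSMul.algebraMap_injective ℝ ℂ).injOn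
  let s : Finset ℝ := insert x hfin.toFinset
  let p : Polynomial ℝ := Lagrange.interpolate s id f
  have hp : ∀ z ∈ s, p.eval z = f z := fun z hz =>
    Lagrange.eval_interpolate_at_node f (Set.injOn_id _) hz
  have hcfc : cfc f T = Polynomial.aeval T p := by
    rw [← cfc_polynomial p T hT]
    exact cfc_congr fun z hz => (hp z (Finset.mem_insert_of_mem (hfin.mem_toFinset.2 hz))).symm
  have haeval : ∀ q : Polynomial ℝ, Polynomial.aeval T q v = ((q.eval x : ℝ) : ℂ) • v := by
    intro q
    induction q using Polynomial.induction_on with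
    | C a => simp [Algebra.algebraMap_eq_smul_one]
    | add q r hq hr => simp [hq, hr, add_smul]
    | monomial n a ih =>
      rw [pow_succ, ← mul_assoc, map_mul, Polynomial.aeval_X, mul_apply_eq_comp, hv, map_smul, ih,
        Polynomial.eval_mul_X, Complex.ofReal_mul, mul_smul, smul_comm]
  rw [hcfc, haeval, hp x (Finset.mem_insert_self _ _)]

section RpowHalf

variable {H : Type} [NormedAddCommGroup H] [InnerProductSpace ℂ H] [CompleteSpace H] {B : Op H}

theorem rpow_half_apply_rpow_half_apply (hB : IsStrictlyPositive B) (v : H) :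
    (B ^ (1 / 2 : ℝ)) ((B ^ (1 / 2 : ℝ)) v) = B v := by
  rw [← mul_apply_eq_comp, ← CFC.rpow_add hB.isUnit, add_halves, CFC.rpow_one B hB.nonneg]

theorem rpow_neg_half_apply_rpow_half_apply (hB : IsStrictlyPositive B) (v : H) :
    (B ^ (-(1 / 2) : ℝ)) ((B ^ (1 / 2 : ℝ)) v) = v :=
  congr($(CFC.rpow_neg_mul_rpow _ hB) v)

theorem rpow_half_apply_rpow_neg_half_apply (hB : IsStrictlyPositive B) (v : H) :
    (B ^ (1 / 2 : ℝ)) ((B ^ (-(1 / 2) : ℝ)) v) = v :=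
  congr($(CFC.rpow_mul_rpow_neg _ hB) v)

end RpowHalf

theorem exists_basis_formMatrix_eq_one {H : Type} [NormedAddCommGroup H] [InnerProductSpace ℂ H]
    [FiniteDimensional ℂ H] [CompleteSpace H] {n : ℕ} (hn : Module.finrank ℂ H = n) {A B : Op H}
    (hA : IsSelfAdjoint A) (hB : IsStrictlyPositive B) :
    ∃ (b : Module.Basis (Fin n) ℂ H) (x : Fin n → ℝ),
      formMatrix B b = 1 ∧ ∀ j, A (b j) = (x j : ℂ) • B (b j) := by
  have hSS := rpow_half_apply_rpow_half_apply hB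
  have hRS := rpow_neg_half_apply_rpow_half_apply hB
  have hSR := rpow_half_apply_rpow_neg_half_apply hB
  have hR : IsSelfAdjoint (B ^ (-(1 / 2) : ℝ)) := .of_nonneg CFC.rpow_nonneg
  set S : Op H := B ^ (1 / 2 : ℝ)
  set R : Op H := B ^ (-(1 / 2) : ℝ)
  have hXs : (R * A * R).IsSymmetric := (hA.conjugate_self hR).isSymmetric
  let e := hXs.eigenvectorBasis hn
  have he : ∀ j, R (A (R (e j))) = ((hXs.eigenvalues hn j : ℝ) : ℂ) • e j :=
    hXs.apply_eigenvectorBasis hn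
  let L : H ≃ₗ[ℂ] H := LinearEquiv.ofLinearMap (R : H →ₗ[ℂ] H) (S : H →ₗ[ℂ] H)
    (LinearMap.ext hRS) (LinearMap.ext hSR)
  have hb : ∀ j, e.toBasis.map L j = R (e j) := fun j => by simp [L]
  refine ⟨e.toBasis.map L, hXs.eigenvalues hn, ?_, fun j => ?_⟩
  · ext i j
    rw [formMatrix_apply, hb, hb, ← hSS, hSR, ← ContinuousLinearMap.adjoint_inner_right,
      hR.adjoint_eq, hRS, Matrix.one_apply]
    exact orthonormal_iff_ite.1 e.orthonormal i j
  · rw [hb, ← hSS, hSR, ← map_smul, ← he, hSR]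

variable {d : ℕ} {A B : Op (CSpace d)}

theorem kuboAndo_apply_of_eigenvector (hB : IsStrictlyPositive B) (hA : 0 ≤ A) (t : ℝ)
    {v : CSpace d} {x : ℝ} (hv : A v = (x : ℂ) • B v) :
    kuboAndo t B A v = ((x ^ t : ℝ) : ℂ) • B v := by
  have hSS := rpow_half_apply_rpow_half_apply hB
  have hRS := rpow_neg_half_apply_rpow_half_apply hB
  have hR : IsSelfAdjoint (B ^ (-(1 / 2) : ℝ)) := .of_nonneg CFC.rpow_nonneg
  rw [kuboAndo]
  set S : Op (CSpace d) := B ^ (1 / 2 : ℝ)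
  set R : Op (CSpace d) := B ^ (-(1 / 2) : ℝ)
  have heig : (R * A * R) (S v) = (x : ℂ) • S v := by
    rw [mul_apply_eq_comp, mul_apply_eq_comp, hRS, hv, map_smul, ← hSS, hRS]
  have hX : 0 ≤ R * A * R := hR.conjugate_nonneg hA
  have hpow : ((R * A * R) ^ t) (S v) = ((x ^ t : ℝ) : ℂ) • S v := by
    rw [CFC.rpow_eq_cfc_real hX]
    exact cfc_apply_of_eigenvector (.of_nonneg hX) _ heig
  rw [mul_apply_eq_comp, mul_apply_eq_comp, hpow, map_smul, hSS]

theorem eq_kuboAndo_iff (hB : IsStrictlyPositive B) (hA : 0 ≤ A) {t : ℝ} {T : Op (CSpace d)} :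
    T = kuboAndo t B A ↔
      ∀ (v : CSpace d) (x : ℝ), A v = (x : ℂ) • B v → T v = ((x ^ t : ℝ) : ℂ) • B v := by
  refine ⟨?_, fun h => ?_⟩
  · rintro rfl v x hv
    exact kuboAndo_apply_of_eigenvector hB hA t hv
  · obtain ⟨b, x, -, hx⟩ := exists_basis_formMatrix_eq_one (finrank_euclideanSpace_fin (n := d))
      (.of_nonneg hA) hB
    refine ContinuousLinearMap.coe_injective (b.ext fun j => ?_)
    exact (h _ _ (hx j)).trans (kuboAndo_apply_of_eigenvector hB hA t (hx j)).symm

theorem kuboAndo_self (hB : IsStrictlyPositive B) (t : ℝ) : kuboAndo t B B = B := by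
  ext1 v
  simpa using kuboAndo_apply_of_eigenvector hB hB.nonneg t (v := v) (x := 1) (by simp)

theorem kuboAndo_injective (hB : IsStrictlyPositive B) (hA : IsStrictlyPositive A) (hAB : A ≠ B) :
    Function.Injective fun t => kuboAndo t B A := by
  intro s t hst
  obtain ⟨b, x, hb, hx⟩ := exists_basis_formMatrix_eq_one (finrank_euclideanSpace_fin (n := d))
    (.of_nonneg hA.nonneg) hB
  obtain ⟨j, hj⟩ : ∃ j, x j ≠ 1 := by
    by_contra! h
    exact hAB (ContinuousLinearMap.coe_injective (b.ext fun j => by simp [hx, h]))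
  have hBb : B (b j) ≠ 0 := fun h => b.ne_zero j ((isStrictlyPositive_iff_injective hB.nonneg).1 hB
    (h.trans (map_zero B).symm))
  have hxj : 0 < x j := pos_of_formMatrix_eq_diagonal hA b.linearIndependent
    ((formMatrix_eq_diagonal_iff hb).2 hx) j
  have hpow : ((x j ^ s : ℝ) : ℂ) • B (b j) = ((x j ^ t : ℝ) : ℂ) • B (b j) := by
    rw [← kuboAndo_apply_of_eigenvector hB hA.nonneg s (hx j),
      ← kuboAndo_apply_of_eigenvector hB hA.nonneg t (hx j)]
    exact congr($hst (b j))
  exact (Real.rpow_right_inj hxj hj).1 (Complex.ofReal_injective (smul_left_injective ℂ hBb hpow))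

end KuboAndo

section Tensor

variable {d n : ℕ}

theorem inner_tensorVec (v w : Fin n → CSpace d) :
    inner ℂ (tensorVec v) (tensorVec w) = ∏ k, inner ℂ (v k) (w k) := by
  simp only [PiLp.inner_apply, tensorVec, Finset.prod_univ_sum, Fintype.piFinset_univ,
    RCLike.inner_apply, map_prod, Finset.prod_mul_distrib]

/-- The totally antisymmetric vector `∑ σ, sign σ • e_{σ 1} ⊗ ⋯ ⊗ e_{σ d}`, on which `T^{⊗ d}`
acts as multiplication by `det T`. -/
def antisymmVec (d : ℕ) : TensorSpace d d :=
  ∑ σ : Equiv.Perm (Fin d), ((Equiv.Perm.sign σ : ℤ) : ℂ) •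
    tensorVec fun k => EuclideanSpace.single (σ k) 1

theorem antisymmVec_apply (i : Fin d → Fin d) :
    antisymmVec d i = ((1 : Matrix (Fin d) (Fin d) ℂ).submatrix i id).det := by
  rw [← Matrix.det_transpose, Matrix.det_apply']
  simp only [antisymmVec, WithLp.ofLp_sum, Finset.sum_apply, PiLp.smul_apply, tensorVec,
    smul_eq_mul]
  refine Finset.sum_congr rfl fun σ _ => ?_
  congr 1
  refine Finset.prod_congr rfl fun k _ => ?_
  simp [Matrix.one_apply]

theorem antisymmVec_ne_zero (d : ℕ) : antisymmVec d ≠ 0 := by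
  intro h
  have hid := antisymmVec_apply (d := d) id
  simp [h] at hid

theorem tensorPow_antisymmVec (T : Op (CSpace d)) :
    tensorPow d T (antisymmVec d) =
      LinearMap.det (T : CSpace d →ₗ[ℂ] CSpace d) • antisymmVec d := by
  let M : Matrix (Fin d) (Fin d) ℂ := Matrix.of fun i j => T (EuclideanSpace.single j 1) i
  have hM : LinearMap.det (T : CSpace d →ₗ[ℂ] CSpace d) = M.det := by
    rw [← LinearMap.det_toMatrix (EuclideanSpace.basisFun (Fin d) ℂ).toBasis]
    rfl
  ext i
  have hsub : M.submatrix i id = (1 : Matrix (Fin d) (Fin d) ℂ).submatrix i id * M := by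
    ext a b
    simp [Matrix.mul_apply, Matrix.one_apply]
  rw [PiLp.smul_apply, antisymmVec_apply, smul_eq_mul, mul_comm, hM, ← Matrix.det_mul, ← hsub,
    ← Matrix.det_transpose, Matrix.det_apply', antisymmVec]
  simp only [map_sum, map_smul, tensorPow_tensorVec]
  simp only [WithLp.ofLp_sum, Finset.sum_apply, PiLp.smul_apply, tensorVec, smul_eq_mul]
  rfl

theorem exists_prod_comp_eq_prod_pow {ι M : Type*} [Fintype ι] [CommMonoid M] (e : ι → ℕ) :
    ∃ w : Fin (∑ i, e i) → ι, ∀ f : ι → M, ∏ k, f (w k) = ∏ i, f i ^ e i := by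
  let E : Fin (∑ i, e i) ≃ (i : ι) × Fin (e i) := (Fintype.equivFinOfCardEq (by simp)).symm
  refine ⟨fun k => (E k).1, fun f => ?_⟩
  rw [E.prod_comp fun z => f z.1, Fintype.prod_sigma]
  simp

end Tensor

section Determinants

open scoped ComplexOrder

variable {H : Type} [NormedAddCommGroup H] [InnerProductSpace ℂ H] [FiniteDimensional ℂ H]
  [CompleteSpace H] {T : Op H}

theorem det_pos_of_isStrictlyPositive (hT : IsStrictlyPositive T) :
    0 < LinearMap.det (T : H →ₗ[ℂ] H) := by
  have hpos : ∀ {S : Op H}, IsStrictlyPositive S →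
      0 < (formMatrix S (stdOrthonormalBasis ℂ H).toBasis).det := fun hS =>
    (posDef_formMatrix hS (stdOrthonormalBasis ℂ H).toBasis.linearIndependent).det_pos
  have hdet := hpos hT
  rw [det_formMatrix] at hdet
  exact (pos_iff_pos_of_mul_pos hdet).1 (hpos isStrictlyPositive_one)

theorem isStrictlyPositive_of_det_ne_zero (hT : 0 ≤ T)
    (hdet : LinearMap.det (T : H →ₗ[ℂ] H) ≠ 0) : IsStrictlyPositive T :=
  (isStrictlyPositive_iff_injective hT).2
    (LinearMap.ker_eq_bot.1 (not_not.1 (LinearMap.det_eq_zero_iff_ker_ne_bot.not.1 hdet)))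

end Determinants

theorem eq_toScalar_smul_one (T : Op (CSpace 1)) : T = toScalar T • 1 := by
  ext x i
  have hx : x = x 0 • EuclideanSpace.single 0 (1 : ℂ) := by
    ext l
    fin_cases l
    simp
  obtain rfl : i = 0 := Subsingleton.elim _ _
  conv_lhs => rw [hx]
  simp [toScalar, mul_comm]

section DirectSum

variable {r : ℕ} {H : Fin r → Type} [∀ i, NormedAddCommGroup (H i)] [∀ i, InnerProductSpace ℂ (H i)]

/-- The inclusion of a summand into a Hilbert space direct sum. -/
def directSumIncl (i : Fin r) : H i →ₗᵢ[ℂ] PiLp 2 H where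
  toFun := PiLp.single 2 i
  map_add' _ _ := PiLp.single_add 2 i
  map_smul' c x := (congr_arg (WithLp.toLp 2) (Pi.single_smul i c x)).trans (WithLp.toLp_smul 2 c _)
  norm_map' := PiLp.norm_single 2 H i

theorem directSumIncl_apply (i : Fin r) (x : H i) : directSumIncl i x = PiLp.single 2 i x := rfl

theorem directSumOp_directSumIncl (A : ∀ i, Op (H i)) (i : Fin r) (x : H i) :
    directSumOp A (directSumIncl i x) = directSumIncl i (A i x) := by
  ext1 j
  rw [directSumOp_apply, directSumIncl_apply, directSumIncl_apply]
  rcases eq_or_ne j i with rfl | hj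
  · simp
  · simp [Pi.single_eq_of_ne hj]

theorem injective_directSumOp {A : ∀ i, Op (H i)} (hA : ∀ i, Function.Injective (A i)) :
    Function.Injective (directSumOp A) := fun v w hvw => by
  ext1 i
  exact hA i (congr_arg (fun z : PiLp 2 H => z i) hvw)

end DirectSum

namespace PositiveOperatorFunction

variable {Y : Type} {G : PositiveOperatorFunction Y}

section Extension

variable {H K : Type} [NormedAddCommGroup H] [InnerProductSpace ℂ H] [FiniteDimensional ℂ H]
  [NormedAddCommGroup K] [InnerProductSpace ℂ K] [FiniteDimensional ℂ K] {d : ℕ}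

theorem nontrivial_of_mem_dom {A : Y → Op (CSpace d)} (hA : A ∈ G.dom d) : Nontrivial (CSpace d) :=
  Module.nontrivial_of_finrank_pos (R := ℂ) (by simpa using G.dim_pos hA)

theorem mem_domOn_of_mem_dom {A : Y → Op (CSpace d)} (hA : A ∈ G.dom d) : A ∈ G.domOn (CSpace d) :=
  ⟨d, LinearIsometryEquiv.refl ℂ (CSpace d), hA⟩

theorem valOn_eq_toFun {A : Y → Op (CSpace d)} (hA : A ∈ G.dom d) : G.valOn A = G.toFun d A :=
  G.valOn_eq (LinearIsometryEquiv.refl ℂ (CSpace d)) A (mem_domOn_of_mem_dom hA)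

theorem valOn_unitaryConj (V : H ≃ₗᵢ[ℂ] K) {A : Y → Op H} (hA : A ∈ G.domOn H) :
    (fun y => unitaryConj V (A y)) ∈ G.domOn K ∧
      G.valOn (fun y => unitaryConj V (A y)) = unitaryConj V (G.valOn A) := by
  obtain ⟨d, W, hW⟩ := hA
  have hconj : (fun y => unitaryConj (V.symm.trans W) (unitaryConj V (A y))) =
      fun y => unitaryConj W (A y) := by
    ext y x
    simp
  have hmem : (fun y => unitaryConj V (A y)) ∈ G.domOn K := ⟨d, V.symm.trans W, by rwa [hconj]⟩
  refine ⟨hmem, ?_⟩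
  rw [G.valOn_eq (V.symm.trans W) _ hmem, hconj, G.valOn_eq W A ⟨d, W, hW⟩]
  rfl

end Extension

section Reduction

variable {H K : Type} [NormedAddCommGroup H] [InnerProductSpace ℂ H] [FiniteDimensional ℂ H]
  [NormedAddCommGroup K] [InnerProductSpace ℂ K] [FiniteDimensional ℂ K] {d : ℕ}

theorem valOn_apply_directSumIncl (hblock : G.BlockAdditive) {r : ℕ} {H : Fin r → Type}
    [∀ i, NormedAddCommGroup (H i)] [∀ i, InnerProductSpace ℂ (H i)]
    [∀ i, FiniteDimensional ℂ (H i)] {A : Y → Op K} {B : ∀ i, Y → Op (H i)}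
    (hB : ∀ i, B i ∈ G.domOn (H i)) (U : PiLp 2 H ≃ₗᵢ[ℂ] K)
    (hU : ∀ y w, A y (U w) = U (directSumOp (fun i => B i y) w)) (i : Fin r) (x : H i) :
    G.valOn A (U (directSumIncl i x)) = U (directSumIncl i (G.valOn (B i) x)) := by
  obtain ⟨hmem, hval⟩ := hblock r (Fin.pos i) H B hB
  have hconj : (fun y => unitaryConj U (directSumOp fun i => B i y)) = A := by
    ext y v
    rw [unitaryConj_apply, ← hU, U.apply_symm_apply]
  rw [← hconj, (valOn_unitaryConj U hmem).2, unitaryConj_apply, U.symm_apply_apply, hval,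
    directSumOp_directSumIncl]

theorem toFun_apply_of_isInternal (hblock : G.BlockAdditive) (hred : G.ReductionProperty)
    {r : ℕ} {A : Y → Op (CSpace d)} (hA : A ∈ G.dom d) {F : Fin r → Submodule ℂ (CSpace d)}
    (hF0 : ∀ i, F i ≠ ⊥) (horth : OrthogonalFamily ℂ (fun i => F i) fun i => (F i).subtypeₗᵢ)
    (hint : DirectSum.IsInternal F) (hF : ∀ i y, MapsTo (A y) (F i) (F i)) (i : Fin r) (x : F i) :
    G.toFun d A x = (G.valOn (fun y => ((A y).restrict (hF i y) : Op (F i))) x : F i) := by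
  obtain ⟨U, hU⟩ : ∃ U : CSpace d ≃ₗᵢ[ℂ] PiLp 2 fun i => F i,
      ∀ w, U.symm w = ∑ i, (w i : CSpace d) :=
    ⟨hint.isometryL2OfOrthogonalFamily horth, hint.isometryL2OfOrthogonalFamily_symm_apply horth⟩
  have hincl : ∀ z : F i, U.symm (directSumIncl (H := fun i => F i) i z) = z := by
    intro z
    rw [hU, directSumIncl_apply, Finset.sum_eq_single i
      (fun j _ hj => by simp [Pi.single_eq_of_ne hj]) (by simp), PiLp.single_eq_same]
  have hUA : ∀ y w, A y (U.symm w) =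
      U.symm (directSumOp (fun i => ((A y).restrict (hF i y) : Op (F i))) w) := by
    intro y w
    rw [hU, hU, map_sum]
    rfl
  have hval := valOn_apply_directSumIncl hblock
    (fun i => hred d A hA (F i) (hF0 i) (hF i)) U.symm hUA i x
  rwa [hincl, hincl, valOn_eq_toFun hA] at hval

theorem toFun_apply_of_invariant (hblock : G.BlockAdditive) (hred : G.ReductionProperty)
    {A : Y → Op (CSpace d)} (hA : A ∈ G.dom d) {F : Submodule ℂ (CSpace d)} (hF0 : F ≠ ⊥)
    (hF : ∀ y, MapsTo (A y) F F) (x : F) :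
    G.toFun d A x = (G.valOn (fun y => ((A y).restrict (hF y) : Op F)) x : F) := by
  by_cases hperp : Fᗮ = ⊥
  · obtain rfl : F = ⊤ := Submodule.orthogonal_eq_bot_iff.1 hperp
    rw [G.valOn_eq (LinearIsometryEquiv.ofTop (CSpace d) ⊤ rfl) _ (hred d A hA ⊤ hF0 hF)]
    rfl
  have hFperp : ∀ y, MapsTo (A y) Fᗮ Fᗮ := by
    intro y v hv w hw
    have hsymm := ((ContinuousLinearMap.nonneg_iff_isPositive _).1
      (G.nonneg_of_mem_dom hA y)).isSymmetric
    exact (hsymm w v).symm.trans (hv _ (hF y hw))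
  have horth : OrthogonalFamily ℂ (fun i => (![F, Fᗮ] : Fin 2 → Submodule ℂ (CSpace d)) i)
      fun i => (![F, Fᗮ] i).subtypeₗᵢ := by
    refine OrthogonalFamily.of_pairwise fun i j hij => ?_
    fin_cases i <;> fin_cases j
    · exact absurd rfl hij
    · exact Submodule.isOrtho_orthogonal_right F
    · exact Submodule.isOrtho_orthogonal_left F
    · exact absurd rfl hij
  have hint : DirectSum.IsInternal ![F, Fᗮ] := by
    rw [horth.isInternal_iff, Submodule.orthogonal_eq_bot_iff, eq_top_iff,
      ← Submodule.sup_orthogonal_of_hasOrthogonalProjection (K := F)]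
    exact sup_le (le_iSup ![F, Fᗮ] 0) (le_iSup ![F, Fᗮ] 1)
  exact toFun_apply_of_isInternal hblock hred hA (F := ![F, Fᗮ]) (Fin.forall_fin_two.2 ⟨hF0, hperp⟩)
    horth hint (Fin.forall_fin_two.2 ⟨hF, hFperp⟩) 0 x

theorem valOn_apply_of_intertwine (hblock : G.BlockAdditive) (hred : G.ReductionProperty)
    [Nontrivial H] (J : H →ₗᵢ[ℂ] K) {A : Y → Op K} {B : Y → Op H} (hA : A ∈ G.domOn K)
    (hAB : ∀ y x, A y (J x) = J (B y x)) :
    B ∈ G.domOn H ∧ ∀ x, G.valOn A (J x) = J (G.valOn B x) := by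
  obtain ⟨d, V, hV⟩ := id hA
  let I : H →ₗᵢ[ℂ] CSpace d := V.toLinearIsometry.comp J
  let F : Submodule ℂ (CSpace d) := LinearMap.range I.toLinearMap
  let U : H ≃ₗᵢ[ℂ] F := I.equivRange
  have hI : ∀ y x, unitaryConj V (A y) (I x) = I (B y x) := by
    intro y x
    simp [I, hAB]
  have hF : ∀ y, MapsTo (unitaryConj V (A y)) F F := by
    rintro y _ ⟨x, rfl⟩
    exact ⟨B y x, (hI y x).symm⟩
  have hF0 : F ≠ ⊥ := by
    obtain ⟨x, hx⟩ := exists_ne (0 : H)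
    exact F.ne_bot_iff.2 ⟨I x, ⟨x, rfl⟩, (map_ne_zero_iff I I.injective).2 hx⟩
  let R (y : Y) : Op F := (unitaryConj V (A y)).restrict (hF y)
  have hR : ∀ y, unitaryConj U.symm (R y) = B y := by
    intro y
    ext1 x
    exact (U.symm_apply_eq).2 (Subtype.ext (hI y x))
  obtain ⟨hmem, hval⟩ := valOn_unitaryConj (A := R) U.symm (hred d _ hV F hF0 hF)
  simp only [hR] at hmem hval
  refine ⟨hmem, fun x => ?_⟩
  rw [G.valOn_eq V A hA, hval, unitaryConj_apply, LinearIsometryEquiv.symm_symm, V.symm_apply_eq]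
  refine (toFun_apply_of_invariant hblock hred hV hF0 hF (U x)).trans ?_
  exact congr_arg Subtype.val (U.apply_symm_apply _).symm

end Reduction

section ScalarFamilies

variable (G)

/-- The scalar families `a` on which `G` is defined, that is, those for which `(a_y I)_y` on `ℂ^1`
is in the domain of `G`. -/
def scalarDom : Set (Y → ℂ) :=
  {a | (fun y => a y • (1 : Op (CSpace 1))) ∈ G.dom 1}

/-- The value of `G` on a scalar family; it has no meaning outside of `scalarDom`. -/
def scalarVal (a : Y → ℂ) : ℂ :=
  toScalar (G.toFun 1 fun y => a y • 1)

variable {G}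

theorem valOn_apply_of_eigenvector {H : Type} [NormedAddCommGroup H] [InnerProductSpace ℂ H]
    [FiniteDimensional ℂ H] (hblock : G.BlockAdditive) (hred : G.ReductionProperty) {A : Y → Op H}
    (hA : A ∈ G.domOn H) {v : H} (hv : v ≠ 0) {a : Y → ℂ} (h : ∀ y, A y v = a y • v) :
    a ∈ G.scalarDom ∧ G.valOn A v = G.scalarVal a • v := by
  obtain ⟨J, hJ⟩ : ∃ J : CSpace 1 →ₗᵢ[ℂ] H, ∀ z, J z = z 0 • (‖v‖ : ℂ)⁻¹ • v := by
    let L : CSpace 1 →ₗ[ℂ] H :=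
      (LinearMap.toSpanSingleton ℂ H ((‖v‖ : ℂ)⁻¹ • v)).comp (EuclideanSpace.projₗ (𝕜 := ℂ) 0)
    refine ⟨⟨L, fun z => ?_⟩, fun z => rfl⟩
    simp [L, EuclideanSpace.norm_eq, norm_smul, hv]
  have hJv : J (EuclideanSpace.single 0 (‖v‖ : ℂ)) = v := by
    simp [hJ, hv]
  obtain ⟨hmem, hval⟩ := valOn_apply_of_intertwine hblock hred J hA (B := fun y => a y • 1)
    fun y z => by simp [hJ, h, smul_smul, mul_comm, mul_left_comm]
  have ha : a ∈ G.scalarDom := (G.mem_domOn_iff (LinearIsometryEquiv.refl ℂ _) _).1 hmem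
  refine ⟨ha, ?_⟩
  rw [← hJv, hval, valOn_eq_toFun ha, eq_toScalar_smul_one (G.toFun 1 _), ← map_smul]
  rfl

theorem scalarVal_det (htens : G.TensorMultiplicative) (hblock : G.BlockAdditive)
    (hred : G.ReductionProperty) {d : ℕ} {A : Y → Op (CSpace d)} (hA : A ∈ G.dom d) :
    (fun y => LinearMap.det (A y : CSpace d →ₗ[ℂ] CSpace d)) ∈ G.scalarDom ∧
      G.scalarVal (fun y => LinearMap.det (A y : CSpace d →ₗ[ℂ] CSpace d)) =
        LinearMap.det (G.toFun d A : CSpace d →ₗ[ℂ] CSpace d) := by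
  obtain ⟨hmem, hval⟩ := htens d A hA d (G.dim_pos hA)
  obtain ⟨hdet, heig⟩ := valOn_apply_of_eigenvector hblock hred hmem (antisymmVec_ne_zero d)
    fun y => tensorPow_antisymmVec (A y)
  refine ⟨hdet, ?_⟩
  rw [hval, tensorPow_antisymmVec] at heig
  exact (smul_left_injective ℂ (antisymmVec_ne_zero d) heig).symm

theorem scalarVal_mul (hscal : G.ScalarTensorMultiplicative) {a b : Y → ℂ} (ha : a ∈ G.scalarDom)
    (hb : b ∈ G.scalarDom) :
    a * b ∈ G.scalarDom ∧ G.scalarVal (a * b) = G.scalarVal a * G.scalarVal b := by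
  obtain ⟨hmem, hval⟩ := hscal _ ha 1 _ hb
  simp only [toScalar_smul_one, smul_smul] at hmem hval
  exact ⟨hmem, congr_arg toScalar hval⟩

theorem valOn_smul (hscal : G.ScalarTensorMultiplicative) {H : Type} [NormedAddCommGroup H]
    [InnerProductSpace ℂ H] [FiniteDimensional ℂ H] {a : Y → ℂ} (ha : a ∈ G.scalarDom)
    {A : Y → Op H} (hA : A ∈ G.domOn H) :
    (fun y => a y • A y) ∈ G.domOn H ∧
      G.valOn (fun y => a y • A y) = G.scalarVal a • G.valOn A := by
  obtain ⟨d, V, hV⟩ := id hA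
  obtain ⟨hmem, hval⟩ := hscal _ ha d _ hV
  have hconj : (fun y => toScalar (a y • 1) • unitaryConj V (A y)) =
      fun y => unitaryConj V (a y • A y) := by
    ext y v
    simp [toScalar_smul_one]
  rw [hconj] at hmem hval
  refine ⟨⟨d, V, hmem⟩, ?_⟩
  rw [G.valOn_eq V _ ⟨d, V, hmem⟩, hval, G.valOn_eq V A hA]
  ext v
  simp [scalarVal]

theorem valOn_pow_smul (hscal : G.ScalarTensorMultiplicative) {H : Type} [NormedAddCommGroup H]
    [InnerProductSpace ℂ H] [FiniteDimensional ℂ H] {a : Y → ℂ} (ha : a ∈ G.scalarDom)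
    {A : Y → Op H} (hA : A ∈ G.domOn H) (n : ℕ) :
    (fun y => a y ^ n • A y) ∈ G.domOn H ∧
      G.valOn (fun y => a y ^ n • A y) = G.scalarVal a ^ n • G.valOn A := by
  induction n with
  | zero => simpa using hA
  | succ n ih =>
    have hsucc := valOn_smul hscal ha ih.1
    simpa only [ih.2, smul_smul, ← pow_succ'] using hsucc

open scoped ComplexOrder

theorem scalarVal_pos (hpos : G.StrictlyScalarPositive) {a : Y → ℂ} (ha : a ∈ G.scalarDom)
    (ha0 : ∀ y, 0 < a y) : 0 < G.scalarVal a := by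
  have hdet := det_pos_of_isStrictlyPositive
    (hpos _ ⟨ha, fun y => .smul (ha0 y) isStrictlyPositive_one⟩)
  rw [eq_toScalar_smul_one (G.toFun 1 _)] at hdet
  simpa [LinearMap.det_smul, scalarVal] using hdet

theorem scalarVal_inv (hpos : G.StrictlyScalarPositive) (hscal : G.ScalarTensorMultiplicative)
    (hinv : G.ScalarDomainInvClosed) {a : Y → ℂ} (ha : a ∈ G.scalarDom) (ha0 : ∀ y, 0 < a y) :
    a⁻¹ ∈ G.scalarDom ∧ G.scalarVal a⁻¹ = (G.scalarVal a)⁻¹ := by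
  have hinv_mem : a⁻¹ ∈ G.scalarDom := by
    have hre : ∀ y, a y = ((a y).re : ℂ) := fun y => Complex.eq_re_of_ofReal_le (ha0 y).le
    have hmem := hinv (fun y => (a y).re) (fun y => (Complex.pos_iff.1 (ha0 y)).1)
    simp only [Complex.ofReal_inv, ← hre] at hmem
    exact hmem ha
  have hone : a * a⁻¹ = 1 := funext fun y => mul_inv_cancel₀ (ha0 y).ne'
  obtain ⟨hone_mem, hval⟩ := scalarVal_mul hscal ha hinv_mem
  rw [hone] at hone_mem hval
  have hidem := (scalarVal_mul hscal hone_mem hone_mem).2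
  rw [mul_one, left_eq_mul₀ (scalarVal_pos hpos hone_mem fun _ => one_pos).ne'] at hidem
  exact ⟨hinv_mem, eq_inv_of_mul_eq_one_right (hval.symm.trans hidem)⟩

theorem isStrictlyPositive_toFun (hpos : G.StrictlyScalarPositive)
    (htens : G.TensorMultiplicative) (hblock : G.BlockAdditive) (hred : G.ReductionProperty)
    {d : ℕ} {A : Y → Op (CSpace d)} (hA : A ∈ G.domPos d) : IsStrictlyPositive (G.toFun d A) := by
  obtain ⟨hdet, hval⟩ := scalarVal_det htens hblock hred hA.1
  exact isStrictlyPositive_of_det_ne_zero (G.nonneg hA.1) (hval ▸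
    (scalarVal_pos hpos hdet fun y => det_pos_of_isStrictlyPositive (hA.2 y)).ne')

end ScalarFamilies

section TestVectors

open scoped ComplexOrder

variable [Fintype Y]

theorem inner_toFun_le (hAM : G.AsymptoticallyIndividuallyAMBounded) {d : ℕ}
    {A : Y → Op (CSpace d)} (hA : A ∈ G.dom d) (φ : CSpace d) {M : ℂ} (hM : 0 ≤ M)
    (h : ∀ y, inner ℂ φ (A y φ) ≤ M) : inner ℂ φ (G.toFun d A φ) ≤ M := by
  have hreal : ∀ {T : Op (CSpace d)}, 0 ≤ T → ∃ p : ℝ, 0 ≤ p ∧ inner ℂ φ (T φ) = p := by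
    intro T hT
    have hinner := ((ContinuousLinearMap.nonneg_iff_isPositive _).1 hT).inner_nonneg_right φ
    exact ⟨_, (Complex.nonneg_iff.1 hinner).1, Complex.eq_re_of_ofReal_le hinner⟩
  choose p hp0 hp using fun y => hreal (G.nonneg_of_mem_dom hA y)
  obtain ⟨u, -, hu⟩ := hreal (G.nonneg hA)
  obtain ⟨r, hr, rfl⟩ : ∃ r : ℝ, 0 ≤ r ∧ (r : ℂ) = M := RCLike.nonneg_iff_exists_ofReal.1 hM
  simp only [hp, hu, Complex.real_le_real] at h ⊢
  refine le_of_forall_gt_imp_ge_of_dense fun s hs => ?_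
  have hs0 : 0 < s := hr.trans_lt hs
  obtain ⟨μ, hμ, hlim⟩ := hAM d A hA
  suffices u / s ≤ 1 from (div_le_one hs0).1 this
  refine le_one_of_pow_le_of_limsup_log_le hlim fun n hn => ?_
  have hpow : u ^ n ≤ ∑ y, (μ n y : ℝ) * p y ^ n := by
    have hinner := ((ContinuousLinearMap.le_def _ _).1 (hμ n hn)).inner_nonneg_right
      (tensorVec fun _ => φ)
    simp only [sub_apply, sum_apply, smul_apply, inner_sub_right, inner_sum, inner_smul_right,
      tensorPow_tensorVec, inner_tensorVec, hu, hp, Finset.prod_const, Finset.card_univ,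
      Fintype.card_fin, sub_nonneg] at hinner
    exact_mod_cast hinner
  have hdiv : (u / s) ^ n ≤ ∑ y, (μ n y : ℝ) := by
    rw [div_pow, div_le_iff₀ (by positivity), Finset.sum_mul]
    refine hpow.trans (Finset.sum_le_sum fun y _ => ?_)
    have hpy := hp0 y
    have hps := (h y).trans hs.le
    gcongr
  refine (ENNReal.ofReal_le_ofReal hdiv).trans_eq ?_
  rw [← NNReal.coe_sum, ENNReal.ofReal_coe_nnreal]
  push_cast
  rfl

theorem inner_valOn_le (hAM : G.AsymptoticallyIndividuallyAMBounded) {H : Type}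
    [NormedAddCommGroup H] [InnerProductSpace ℂ H] [FiniteDimensional ℂ H] {A : Y → Op H}
    (hA : A ∈ G.domOn H) (φ : H) {M : ℂ} (hM : 0 ≤ M) (h : ∀ y, inner ℂ φ (A y φ) ≤ M) :
    inner ℂ φ (G.valOn A φ) ≤ M := by
  obtain ⟨d, V, hV⟩ := id hA
  have hconj : ∀ T : Op H, inner ℂ (V φ) (unitaryConj V T (V φ)) = inner ℂ φ (T φ) := fun T => by
    rw [unitaryConj_apply, V.symm_apply_apply, V.inner_map_map]
  rw [← hconj, G.valOn_eq V A hA, unitaryConj_self_symm]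
  exact inner_toFun_le hAM hV (V φ) hM fun y => (hconj (A y)).trans_le (h y)

theorem exists_inner_tensorPow_eq_prod {d : ℕ} {ι : Type} [Fintype ι] (b : ι → CSpace d)
    (e : ι → ℕ) : ∃ φ : TensorSpace d (∑ j, e j), ∀ T : Op (CSpace d),
      inner ℂ φ (tensorPow _ T φ) = ∏ j, formMatrix T b j j ^ e j := by
  obtain ⟨w, hw⟩ := exists_prod_comp_eq_prod_pow (M := ℂ) e
  refine ⟨tensorVec fun k => b (w k), fun T => ?_⟩
  rw [tensorPow_tensorVec, inner_tensorVec]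
  exact hw fun j => formMatrix T b j j

/-- The bound is tested on a product vector of the tensor powers of `A`, rescaled by powers of
the determinants. -/
theorem prod_formMatrix_pow_le (hpos : G.StrictlyScalarPositive)
    (htens : G.TensorMultiplicative) (hscal : G.ScalarTensorMultiplicative)
    (hAM : G.AsymptoticallyIndividuallyAMBounded) (hblock : G.BlockAdditive)
    (hred : G.ReductionProperty) (hinv : G.ScalarDomainInvClosed) {d : ℕ} {A : Y → Op (CSpace d)}
    (hA : A ∈ G.domPos d) {ι : Type} [Fintype ι] [DecidableEq ι]
    (b : Module.Basis ι ℂ (CSpace d)) {e : ι → ℕ} (he : e ≠ 0) (n : ℕ) {M : ℂ} (hM : 0 ≤ M)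
    (h : ∀ y, ∏ j, formMatrix (A y) b j j ^ e j ≤ M * (formMatrix (A y) b).det ^ n) :
    ∏ j, formMatrix (G.toFun d A) b j j ^ e j ≤ M * (formMatrix (G.toFun d A) b).det ^ n := by
  obtain ⟨φ, hφ⟩ := exists_inner_tensorPow_eq_prod b e
  have hN : 1 ≤ ∑ j, e j :=
    Nat.one_le_iff_ne_zero.2 fun h => he (funext fun j => Finset.sum_eq_zero_iff.1 h j (by simp))
  let c : ℂ := (formMatrix (1 : Op (CSpace d)) b).det
  have hc : 0 < c := (posDef_formMatrix isStrictlyPositive_one b.linearIndependent).det_pos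
  have hscale : ∀ {T : Op (CSpace d)}, IsStrictlyPositive T →
      ((LinearMap.det (T : CSpace d →ₗ[ℂ] CSpace d))⁻¹ ^ n * inner ℂ φ (tensorPow _ T φ) ≤
          M * c ^ n ↔
        ∏ j, formMatrix T b j j ^ e j ≤ M * (formMatrix T b).det ^ n) := fun hT => by
    rw [hφ, det_formMatrix, inv_pow, inv_mul_le_iff₀ (pow_pos (det_pos_of_isStrictlyPositive hT) n),
      mul_pow, mul_comm, mul_assoc]
  obtain ⟨hdet, hval_det⟩ := scalarVal_det htens hblock hred hA.1
  obtain ⟨hdet_inv, hval_inv⟩ := scalarVal_inv hpos hscal hinv hdet fun y =>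
    det_pos_of_isStrictlyPositive (hA.2 y)
  obtain ⟨htmem, htval⟩ := htens d A hA.1 _ hN
  obtain ⟨hmem, hval⟩ := valOn_pow_smul hscal hdet_inv htmem n
  have hle := inner_valOn_le hAM hmem φ (mul_nonneg hM (pow_nonneg hc.le n)) fun y => by
    rw [smul_apply, inner_smul_right]
    exact (hscale (hA.2 y)).2 (h y)
  rw [hval, htval, hval_inv, hval_det, smul_apply, inner_smul_right] at hle
  exact (hscale (isStrictlyPositive_toFun hpos htens hblock hred hA)).1 hle

end TestVectors

section Diagonal

open scoped ComplexOrder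

theorem isDiag_formMatrix_toFun [Fintype Y] (hpos : G.StrictlyScalarPositive)
    (htens : G.TensorMultiplicative) (hscal : G.ScalarTensorMultiplicative)
    (hAM : G.AsymptoticallyIndividuallyAMBounded) (hblock : G.BlockAdditive)
    (hred : G.ReductionProperty) (hinv : G.ScalarDomainInvClosed) {d : ℕ} {A : Y → Op (CSpace d)}
    (hA : A ∈ G.domPos d) {ι : Type}
    (b : Module.Basis ι ℂ (CSpace d)) (hdiag : ∀ y, (formMatrix (A y) b).IsDiag) :
    (formMatrix (G.toFun d A) b).IsDiag := by
  classical
  have := Module.Finite.finite_basis b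
  have := Fintype.ofFinite ι
  have := nontrivial_of_mem_dom hA.1
  have := b.index_nonempty
  have hG := isStrictlyPositive_toFun hpos htens hblock hred hA
  refine isDiag_of_posDef_of_prod_diag_le_det (posDef_formMatrix hG b.linearIndependent) ?_
  have hle := prod_formMatrix_pow_le hpos htens hscal hAM hblock hred hinv hA b (e := 1) one_ne_zero
    1 zero_le_one fun y => by
      simp only [Pi.one_apply, pow_one, one_mul]
      conv_rhs => rw [← (hdiag y).diagonal_diag, Matrix.det_diagonal]
      rfl
  simpa using hle

theorem prod_zpow_le [Fintype Y] (hpos : G.StrictlyScalarPositive)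
    (htens : G.TensorMultiplicative) (hscal : G.ScalarTensorMultiplicative)
    (hAM : G.AsymptoticallyIndividuallyAMBounded) (hblock : G.BlockAdditive)
    (hred : G.ReductionProperty) (hinv : G.ScalarDomainInvClosed) {d : ℕ} {A : Y → Op (CSpace d)}
    (hA : A ∈ G.domPos d) {ι : Type} [Fintype ι] [DecidableEq ι]
    {b : Module.Basis ι ℂ (CSpace d)} {x : Y → ι → ℝ} {z : ι → ℝ}
    (hx : ∀ y, formMatrix (A y) b = Matrix.diagonal fun j => (x y j : ℂ))
    (hz : formMatrix (G.toFun d A) b = Matrix.diagonal fun j => (z j : ℂ)) (v : ι → ℤ) {M : ℝ}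
    (hM : 0 ≤ M) (h : ∀ y, ∏ j, x y j ^ v j ≤ M) : ∏ j, z j ^ v j ≤ M := by
  obtain ⟨n, hn⟩ : ∃ n : ℕ, ∀ j, 0 < v j + n := by
    obtain ⟨n, hn⟩ := (Set.finite_range fun j => (-v j).toNat).bddAbove
    refine ⟨n + 1, fun j => ?_⟩
    have hj := hn ⟨j, rfl⟩
    dsimp only at hj
    lia
  have hshift : ∀ {T : Op (CSpace d)} {p : ι → ℝ}, IsStrictlyPositive T →
      formMatrix T b = Matrix.diagonal (fun j => (p j : ℂ)) →
      (∏ j, formMatrix T b j j ^ (v j + n).toNat ≤ M * (formMatrix T b).det ^ n ↔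
        ∏ j, p j ^ v j ≤ M) := by
    intro T p hT hTp
    have hp := pos_of_formMatrix_eq_diagonal hT b.linearIndependent hTp
    simp only [hTp, Matrix.diagonal_apply_eq, Matrix.det_diagonal]
    rw [← mul_le_mul_iff_left₀ (pow_pos (Finset.prod_pos fun j _ => hp j) n),
      ← prod_pow_toNat_add (fun j => (hp j).ne') fun j => (hn j).le]
    norm_cast
  have he : (fun j => (v j + n).toNat) ≠ 0 := by
    have := nontrivial_of_mem_dom hA.1
    obtain ⟨j⟩ := b.index_nonempty
    intro h
    have hj := congr_fun h j
    have hnj := hn j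
    simp only [Pi.zero_apply] at hj
    lia
  have hG := isStrictlyPositive_toFun hpos htens hblock hred hA
  exact (hshift hG hz).1 (prod_formMatrix_pow_le hpos htens hscal hAM hblock hred hinv hA b he n
    (M := (M : ℂ)) (by exact_mod_cast hM) fun y => (hshift (hA.2 y) (hx y)).2 (h y))

theorem exists_toFun_eq_kuboAndo {G : PositiveOperatorFunction (Fin 2)}
    (hpos : G.StrictlyScalarPositive) (htens : G.TensorMultiplicative)
    (hscal : G.ScalarTensorMultiplicative) (hAM : G.AsymptoticallyIndividuallyAMBounded)
    (hblock : G.BlockAdditive) (hred : G.ReductionProperty) (hinv : G.ScalarDomainInvClosed) {d : ℕ}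
    {A : Fin 2 → Op (CSpace d)} (hA : A ∈ G.domPos d) :
    ∃ t ∈ Icc (0 : ℝ) 1, G.toFun d A = kuboAndo t (A 1) (A 0) := by
  obtain ⟨b, x, hb, hx⟩ := exists_basis_formMatrix_eq_one (finrank_euclideanSpace_fin (n := d))
    (.of_nonneg (hA.2 0).nonneg) (hA.2 1)
  have hAx : ∀ y, formMatrix (A y) b = Matrix.diagonal fun j => ((![x, 1] y j : ℝ) : ℂ) :=
    Fin.forall_fin_two.2 ⟨(formMatrix_eq_diagonal_iff hb).2 hx, by simpa using hb⟩
  have hG := isStrictlyPositive_toFun hpos htens hblock hred hA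
  let Z := formMatrix (G.toFun d A) b
  have hZ : Z = Matrix.diagonal fun j => ((Z j j).re : ℂ) := by
    have hdiag : Z.IsDiag := isDiag_formMatrix_toFun hpos htens hscal hAM hblock hred hinv hA b
      fun y => hAx y ▸ Matrix.isDiag_diagonal _
    have hre := (posDef_formMatrix hG b.linearIndependent).isHermitian.coe_re_apply_self
    conv_lhs => rw [← hdiag.diagonal_diag]
    exact congr_arg Matrix.diagonal (funext fun j => (hre j).symm)
  obtain ⟨t, ht, hzx⟩ := exists_rpow_eq_of_prod_zpow_le_max
    (pos_of_formMatrix_eq_diagonal (hA.2 0) b.linearIndependent (hAx 0))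
    (pos_of_formMatrix_eq_diagonal hG b.linearIndependent hZ) fun v =>
      prod_zpow_le hpos htens hscal hAM hblock hred hinv hA hAx hZ v
        (zero_le_one.trans (le_max_right _ _)) (Fin.forall_fin_two.2 ⟨le_max_left _ _, by simp⟩)
  refine ⟨t, ht, ContinuousLinearMap.coe_injective (b.ext fun j => ?_)⟩
  refine ((formMatrix_eq_diagonal_iff hb).1 hZ j).trans ?_
  rw [hzx]
  exact (kuboAndo_apply_of_eigenvector (hA.2 1) (hA.2 0).nonneg t (hx j)).symm

end Diagonal

section Gluing

theorem exists_mem_domPos_intertwine (hblock : G.BlockAdditive) {r : ℕ} (hr : 1 ≤ r)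
    (p : Fin r → Σ d, Y → Op (CSpace d)) (hp : ∀ i, (p i).2 ∈ G.domPos (p i).1) :
    ∃ (D : ℕ) (C : Y → Op (CSpace D)), C ∈ G.domPos D ∧
      ∀ i, ∃ J : CSpace (p i).1 →ₗᵢ[ℂ] CSpace D, ∀ y v, C y (J v) = J ((p i).2 y v) := by
  let S (y : Y) : Op (PiLp 2 fun i => CSpace (p i).1) := directSumOp fun i => (p i).2 y
  have hS : ∀ y, Function.Injective (S y) := fun y => injective_directSumOp fun i =>
    (isStrictlyPositive_iff_injective ((hp i).2 y).nonneg).1 ((hp i).2 y)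
  obtain ⟨D, V, hV⟩ := (hblock r hr (fun i => CSpace (p i).1) (fun i => (p i).2) fun i =>
    mem_domOn_of_mem_dom (hp i).1).1
  refine ⟨D, fun y => unitaryConj V (S y), ⟨hV, fun y => ?_⟩, fun i =>
    ⟨V.toLinearIsometry.comp (directSumIncl (H := fun i => CSpace (p i).1) i), fun y v => ?_⟩⟩
  · exact (isStrictlyPositive_iff_injective (G.nonneg_of_mem_dom hV y)).2
      (V.injective.comp ((hS y).comp V.symm.injective))
  · simp [S, directSumOp_directSumIncl]

theorem exists_toFun_eq_kuboAndo_of_finite {G : PositiveOperatorFunction (Fin 2)}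
    (hpos : G.StrictlyScalarPositive) (htens : G.TensorMultiplicative)
    (hscal : G.ScalarTensorMultiplicative) (hAM : G.AsymptoticallyIndividuallyAMBounded)
    (hblock : G.BlockAdditive) (hred : G.ReductionProperty) (hinv : G.ScalarDomainInvClosed) {r : ℕ}
    (hr : 1 ≤ r) (p : Fin r → Σ d, Fin 2 → Op (CSpace d)) (hp : ∀ i, (p i).2 ∈ G.domPos (p i).1) :
    ∃ t ∈ Icc (0 : ℝ) 1, ∀ i, G.toFun (p i).1 (p i).2 = kuboAndo t ((p i).2 1) ((p i).2 0) := by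
  obtain ⟨D, C, hC, hJ⟩ := exists_mem_domPos_intertwine hblock hr p hp
  obtain ⟨t, ht, htC⟩ := exists_toFun_eq_kuboAndo hpos htens hscal hAM hblock hred hinv hC
  refine ⟨t, ht, fun i => (eq_kuboAndo_iff ((hp i).2 1) ((hp i).2 0).nonneg).2 fun v x hv => ?_⟩
  obtain ⟨J, hCJ⟩ := hJ i
  have : Nontrivial (CSpace (p i).1) := nontrivial_of_mem_dom (hp i).1
  have hGJ := (valOn_apply_of_intertwine hblock hred J (mem_domOn_of_mem_dom hC.1) hCJ).2 v
  rw [valOn_eq_toFun hC.1, valOn_eq_toFun (hp i).1] at hGJ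
  refine J.injective ?_
  rw [← hGJ, map_smul, ← hCJ]
  exact (eq_kuboAndo_iff (hC.2 1) (hC.2 0).nonneg).1 htC (J v) x (by rw [hCJ, hCJ, hv, map_smul])

/-- A pair of distinct operators determines its exponent, and its direct sum with any other pair
forces that exponent on the latter. -/
theorem exists_forall_toFun_eq_kuboAndo {G : PositiveOperatorFunction (Fin 2)}
    (hpos : G.StrictlyScalarPositive) (htens : G.TensorMultiplicative)
    (hscal : G.ScalarTensorMultiplicative) (hAM : G.AsymptoticallyIndividuallyAMBounded)
    (hblock : G.BlockAdditive) (hred : G.ReductionProperty) (hinv : G.ScalarDomainInvClosed) :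
    ∃ t ∈ Icc (0 : ℝ) 1, ∀ (d : ℕ), ∀ A ∈ G.domPos d, G.toFun d A = kuboAndo t (A 1) (A 0) := by
  by_cases hne : ∃ (d : ℕ) (A : Fin 2 → Op (CSpace d)), A ∈ G.domPos d ∧ A 0 ≠ A 1
  · obtain ⟨d, A, hA, hA01⟩ := hne
    obtain ⟨t, ht, htA⟩ := exists_toFun_eq_kuboAndo hpos htens hscal hAM hblock hred hinv hA
    refine ⟨t, ht, fun e B hB => ?_⟩
    obtain ⟨s, -, hs⟩ := exists_toFun_eq_kuboAndo_of_finite hpos htens hscal hAM hblock hred hinv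
      one_le_two ![⟨d, A⟩, ⟨e, B⟩] (Fin.forall_fin_two.2 ⟨hA, hB⟩)
    obtain rfl : s = t := kuboAndo_injective (hA.2 1) (hA.2 0) hA01 ((hs 0).symm.trans htA)
    exact hs 1
  · push Not at hne
    refine ⟨0, by simp, fun d A hA => ?_⟩
    obtain ⟨t, -, htA⟩ := exists_toFun_eq_kuboAndo hpos htens hscal hAM hblock hred hinv hA
    rw [htA, hne d A hA, kuboAndo_self (hA.2 1), kuboAndo_self (hA.2 1)]

open scoped ComplexOrder in
theorem isKuboAndo_toFun_of_regular {G : PositiveOperatorFunction (Fin 2)} {t : ℝ}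
    (h : ∀ (d : ℕ), ∀ A ∈ G.domPos d, G.toFun d A = kuboAndo t (A 1) (A 0)) (hreg : G.Regular)
    (d : ℕ) (A : Fin 2 → Op (CSpace d)) (hA : A ∈ G.dom d) :
    IsKuboAndo t (A 1) (A 0) (G.toFun d A) := by
  obtain ⟨⟨δ, hδ, hmem⟩, hlim⟩ := hreg d A hA
  refine hlim.congr' ?_
  filter_upwards [Ioo_mem_nhdsGT hδ] with ε hε
  exact h d _ ⟨hmem ε hε, fun y => .nonneg_add (G.nonneg_of_mem_dom hA y)
    (.smul (Complex.zero_lt_real.2 hε.1) isStrictlyPositive_one)⟩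

end Gluing

section GeometricMean

open scoped ComplexOrder in
theorem IsWeightedGeometricMean.ofReal_smul_one [Fintype Y] {ν : Y → ℝ}
    (hν : G.IsWeightedGeometricMean ν) {a : Y → ℝ} (ha : ∀ y, 0 < a y) :
    (fun y => (a y : ℂ) • 1) ∈ G.domPos 1 ∧
      G.toFun 1 (fun y => (a y : ℂ) • 1) = ((∏ y, a y ^ ν y : ℝ) : ℂ) • 1 := by
  have hA : ∀ y, IsStrictlyPositive ((a y : ℂ) • (1 : Op (CSpace 1))) := fun y =>
    .smul (Complex.zero_lt_real.2 (ha y)) isStrictlyPositive_one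
  obtain ⟨hmem, hval⟩ := hν 1 le_rfl _ hA fun y z => (Commute.one_left _).smul_left _
  refine ⟨⟨hmem, hA⟩, ?_⟩
  have hone : ∀ r : ℝ, (r : ℂ) • (1 : Op (CSpace 1)) = algebraMap ℝ _ r := fun r =>
    (Algebra.algebraMap_eq_smul_one r).symm
  have hlog : ∑ y, (ν y : ℂ) • CFC.log ((a y : ℂ) • (1 : Op (CSpace 1))) =
      algebraMap ℝ _ (∑ y, Real.log (a y) * ν y) := by
    simp only [hone, CFC.log_algebraMap, map_sum]
    refine Finset.sum_congr rfl fun y _ => ?_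
    rw [← hone, smul_smul, ← Complex.ofReal_mul, hone, mul_comm]
  rw [hval, hlog, ← NormedSpace.algebraMap_exp_comm, ← Real.exp_eq_exp_ℝ, Real.exp_sum, hone]
  simp only [Real.rpow_def_of_pos (ha _)]

theorem IsWeightedGeometricMean.scalarDomainInvClosed [Fintype Y] {ν : Y → ℝ}
    (hν : G.IsWeightedGeometricMean ν) : G.ScalarDomainInvClosed := fun _ ha _ =>
  (hν.ofReal_smul_one fun y => inv_pos.2 (ha y)).1.1

theorem IsWeightedGeometricMean.eq_exponent {G : PositiveOperatorFunction (Fin 2)} {ν : Fin 2 → ℝ}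
    (hν : G.IsWeightedGeometricMean ν) {t : ℝ}
    (h : ∀ (d : ℕ), ∀ A ∈ G.domPos d, G.toFun d A = kuboAndo t (A 1) (A 0)) : ν 0 = t := by
  obtain ⟨hmem, hval⟩ := hν.ofReal_smul_one (a := ![2, 1]) (Fin.forall_fin_two.2 (by simp))
  have hpow := (eq_kuboAndo_iff (hmem.2 1) (hmem.2 0).nonneg).1 (h 1 _ hmem)
    (EuclideanSpace.single 0 1) 2 (by simp)
  rw [hval] at hpow
  have hpow0 : ((2 ^ ν 0 : ℝ) : ℂ) = ((2 ^ t : ℝ) : ℂ) := by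
    simpa using congr_arg (fun v : CSpace 1 => v 0) hpow
  exact (Real.rpow_right_inj two_pos (by norm_num)).1 (Complex.ofReal_injective hpow0)

end GeometricMean

end PositiveOperatorFunction

end

theorem mainTheorem4 (G : PositiveOperatorFunction (Fin 2))
    (hpos : G.StrictlyScalarPositive)
    (htens : G.TensorMultiplicative)
    (hscal : G.ScalarTensorMultiplicative)
    (hAM : G.AsymptoticallyIndividuallyAMBounded)
    (hblock : G.BlockAdditive)
    (hred : G.ReductionProperty) :
    (G.ScalarDomainInvClosed →
      ∃ t ∈ Set.Icc (0 : ℝ) 1,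
        (∀ (d : ℕ), ∀ A ∈ G.domPos d, G.toFun d A = kuboAndo t (A 1) (A 0)) ∧
        (G.Regular → ∀ (d : ℕ), ∀ A ∈ G.dom d, IsKuboAndo t (A 1) (A 0) (G.toFun d A))) ∧
    (∀ ν ∈ stdSimplex ℝ (Fin 2), G.IsWeightedGeometricMean ν →
      (∀ (d : ℕ), ∀ A ∈ G.domPos d, G.toFun d A = kuboAndo (ν 0) (A 1) (A 0)) ∧
      (G.Regular → ∀ (d : ℕ), ∀ A ∈ G.dom d,
        IsKuboAndo (ν 0) (A 1) (A 0) (G.toFun d A))) := by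
  have hexp := PositiveOperatorFunction.exists_forall_toFun_eq_kuboAndo hpos htens hscal hAM hblock
    hred
  refine ⟨fun hinv => ?_, fun ν _ hν => ?_⟩
  · obtain ⟨t, ht, h⟩ := hexp hinv
    exact ⟨t, ht, h, PositiveOperatorFunction.isKuboAndo_toFun_of_regular h⟩
  · obtain ⟨t, -, h⟩ := hexp hν.scalarDomainInvClosed
    obtain rfl := hν.eq_exponent h
    exact ⟨h, PositiveOperatorFunction.isKuboAndo_toFun_of_regular h⟩
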